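/- Let $(X,\mathcal S)$ be a measurable space and let $\mathcal C\subseteq\mathcal S$ be any family of measurable sets. The family $\mathcal C$ shatters a finite set $D\subseteq X$ if every subset of $D$ is of the form $C\cap D$ with $C\in\mathcal C$. The Vapnik–Chervonenkis (VC) dimension of $\mathcal C$ is the supremum in $\{0,1,2,\dots\}\cup\{+\infty\}$ of the cardinalities of the finite sets that $\mathcal C$ shatters (it is $0$ if $\mathcal C=\emptyset$). For a probability measure $\mu$ on $(X,\mathcal S)$, a finite measurable partition $\pi$ of $X$ and $C\in\mathcal C$, the $\pi$-boundary of $C$ is $$\partial(C:\pi)=\bigcup\{A\in\pi:\ \mu(A\cap C)\cdot\mu(A\cap C^c)>0\}.$$ The family $\mathcal C$ is finitely approximable under $\mu$ if for every $\varepsilon>0$ there is a finite measurable partition $\pi$ of $X$ such that $\mu(\partial(C:\pi))\le\varepsilon$ for every $C\in\mathcal C$. Theorem 1. For every probability measure $\mu$ on $(X,\mathcal S)$, either (i) $\mathcal C$ is finitely approximable under $\mu$, or (ii) $\mathcal C$ has infinite VC dimension (the two alternatives are not mutually exclusive). Theorem 2 (equivalent version). If $\mathcal C$ has finite VC dimension,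 then $\mathcal C$ is finitely approximable under every probability measure $\mu$ on $(X,\mathcal S)$. -/

import Mathlib

open MeasureTheory

namespace SetFamily

/-- The family `𝒞` shatters the finite set `D`: every subset of `D` is of the form `C ∩ D` with
`C ∈ 𝒞`. -/
def Shatters {X : Type*} (𝒞 : Set (Set X)) (D : Finset X) : Prop :=
  ∀ E : Set X, E ⊆ (D : Set X) → ∃ C ∈ 𝒞, C ∩ (D : Set X) = E

/-- The Vapnik-Chervonenkis dimension of an arbitrary family of sets: the supremum in `ℕ∞` of the
cardinalities of the finite sets it shatters. It is `⊤` exactly when arbitrarily large finite sets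
are shattered. -/
noncomputable def vcDim {X : Type*} (𝒞 : Set (Set X)) : ℕ∞ :=
  ⨆ (D : Finset X) (_ : Shatters 𝒞 D), (D.card : ℕ∞)

/-- The `π`-boundary of `C` under `μ`: the union of all cells of the finite partition `π` of `X`
that meet both `C` and its complement in positive measure. -/
def boundary {X : Type*} [MeasurableSpace X] (μ : Measure X)
    (π : Finpartition (Set.univ : Set X)) (C : Set X) : Set X :=
  ⋃₀ {A : Set X | A ∈ π.parts ∧ 0 < μ (A ∩ C) * μ (A ∩ Cᶜ)}

/-- `𝒞` is finitely approximable under `μ`: for every `ε > 0` some finite measurable partition `π`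
of `X` satisfies `μ (∂(C : π)) ≤ ε` simultaneously for all `C ∈ 𝒞`. -/
def FinitelyApproximable {X : Type*} [MeasurableSpace X] (μ : Measure X)
    (𝒞 : Set (Set X)) : Prop :=
  ∀ ε : ℝ, 0 < ε → ∃ π : Finpartition (Set.univ : Set X),
    (∀ A ∈ π.parts, MeasurableSet A) ∧
      ∀ C ∈ 𝒞, μ (boundary μ π C) ≤ ENNReal.ofReal ε

end SetFamily

namespace SetFamily

open Filter Topology

variable {X : Type*}

/-! If approximation fails for `ε`, each finite partition `p` has a `C p ∈ 𝒞` whose boundary `D p`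
has mass above `ε`. Along an ultrafilter of ever finer partitions, the restrictions of `μ` to `D p`
converge to a nonzero measure `m ≤ μ`. Let `H` carry `m`, with `μ` absolutely continuous with
respect to `m` on `H`. Any `B ⊆ H` with `μ B > 0` has `m B > 0`, so for fine `p` some boundary cell
lies inside `B`, and `C p` cuts `B` into two non-null pieces. One `p` serves finitely many `B`;
iterating yields `n` independent sets, and dually large shattered sets. -/

/-- A family contains `n` sets in general position for all `n` as soon as finitely many members of
some nonempty collection of nonempty sets can be split simultaneously inside the collection. -/
theorem exists_independent_of_splitting {𝒞 : Set (Set X)} {P : Set X → Prop}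
    (hne : ∀ B, P B → B.Nonempty)
    (hsplit : ∀ 𝓑 : Set (Set X), 𝓑.Finite → (∀ B ∈ 𝓑, P B) →
      ∃ C ∈ 𝒞, ∀ B ∈ 𝓑, P (B ∩ C) ∧ P (B ∩ Cᶜ)) (n : ℕ) :
    ∀ 𝓑 : Set (Set X), 𝓑.Finite → (∀ B ∈ 𝓑, P B) →
      ∃ C : Fin n → Set X, (∀ i, C i ∈ 𝒞) ∧
        ∀ B ∈ 𝓑, ∀ s : Fin n → Prop, ∃ x ∈ B, ∀ i, x ∈ C i ↔ s i := by
  induction n with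
  | zero =>
    intro 𝓑 _ hP
    refine ⟨fun i => i.elim0, fun i => i.elim0, fun B hB s => ?_⟩
    obtain ⟨x, hx⟩ := hne B (hP B hB)
    exact ⟨x, hx, fun i => i.elim0⟩
  | succ n ih =>
    intro 𝓑 hfin hP
    obtain ⟨C, hC, hCB⟩ := hsplit 𝓑 hfin hP
    obtain ⟨C', hC', h'⟩ := ih ((fun B => B ∩ C) '' 𝓑 ∪ (fun B => B ∩ Cᶜ) '' 𝓑)
      ((hfin.image _).union (hfin.image _)) (by
        rintro _ (⟨B, hB, rfl⟩ | ⟨B, hB, rfl⟩)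
        exacts [(hCB B hB).1, (hCB B hB).2])
    refine ⟨Fin.cons C C', ?_, fun B hB s => ?_⟩
    · rw [Fin.forall_fin_succ]
      exact ⟨hC, hC'⟩
    · simp only [Fin.forall_fin_succ, Fin.cons_zero, Fin.cons_succ]
      by_cases h0 : s 0
      · obtain ⟨x, hx, hxs⟩ := h' (B ∩ C) (Or.inl ⟨B, hB, rfl⟩) (fun i => s i.succ)
        exact ⟨x, hx.1, iff_of_true hx.2 h0, hxs⟩
      · obtain ⟨x, hx, hxs⟩ := h' (B ∩ Cᶜ) (Or.inr ⟨B, hB, rfl⟩) (fun i => s i.succ)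
        exact ⟨x, hx.1, iff_of_false hx.2 h0, hxs⟩

/-- A family that contains arbitrarily many sets in general position has infinite VC dimension. -/
theorem vcDim_eq_top_of_independent {𝒞 : Set (Set X)}
    (h : ∀ n, ∃ C : Fin n → Set X, (∀ i, C i ∈ 𝒞) ∧
      ∀ s : Fin n → Prop, ∃ x, ∀ i, x ∈ C i ↔ s i) : vcDim 𝒞 = ⊤ := by
  classical
  refine ENat.eq_top_iff_forall_ge.2 fun k => ?_
  -- Duality: one independent set per subset `T` of `Fin k`; the point `x j` lies in exactly those
  -- with `j ∈ T`.
  obtain ⟨C, hC, hs⟩ := h (Fintype.card (Set (Fin k)))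
  let e := Fintype.equivFin (Set (Fin k))
  choose x hx using fun j : Fin k => hs fun i => j ∈ e.symm i
  have hx' : ∀ (j : Fin k) (T : Set (Fin k)), x j ∈ C (e T) ↔ j ∈ T := fun j T => by
    rw [hx, e.symm_apply_apply]
  have hinj : Function.Injective x := fun a b hab => by
    have := (hx' a {b}).1 (hab ▸ (hx' b {b}).2 rfl)
    exact this
  have hsh : Shatters 𝒞 (Finset.univ.image x) := by
    intro E hE
    refine ⟨C (e (x ⁻¹' E)), hC _, ?_⟩
    ext y
    constructor
    · rintro ⟨hy, hyD⟩
      obtain ⟨j, -, rfl⟩ := Finset.mem_image.1 (Finset.mem_coe.1 hyD)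
      exact (hx' _ _).1 hy
    · intro hy
      obtain ⟨j, -, rfl⟩ := Finset.mem_image.1 (Finset.mem_coe.1 (hE hy))
      exact ⟨(hx' _ _).2 hy, hE hy⟩
  have hcard : (Finset.univ.image x).card = k := by
    rw [Finset.card_image_of_injective _ hinj, Finset.card_univ, Fintype.card_fin]
  calc (k : ℕ∞) = ((Finset.univ.image x).card : ℕ∞) := by rw [hcard]
    _ ≤ vcDim 𝒞 := le_iSup₂ (f := fun (D : Finset X) (_ : Shatters 𝒞 D) => (D.card : ℕ∞)) _ hsh

/-- The pointwise limit along an ultrafilter of measures dominated by a finite measure is again a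
measure. -/
theorem exists_ultrafilter_limit_measure [MeasurableSpace X] {ι : Type*} (U : Ultrafilter ι)
    (μ : Measure X) [IsFiniteMeasure μ] (ν : ι → Measure X) (hν : ∀ i, ν i ≤ μ) :
    ∃ m : Measure X, ∀ B, MeasurableSet B → Tendsto (fun i => ν i B) U (𝓝 (m B)) := by
  have hlim : ∀ B : Set X, ∃ a, Tendsto (fun i => ν i B) U (𝓝 a) := fun B => by
    obtain ⟨a, -, ha⟩ := isCompact_univ.ultrafilter_le_nhds (U.map fun i => ν i B) (by simp)
    exact ⟨a, ha⟩
  choose c hc using hlim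
  have hcμ : ∀ B, c B ≤ μ B := fun B =>
    le_of_tendsto (hc B) (Eventually.of_forall fun i => hν i B)
  have hadd : ∀ (f : ℕ → Set X), (∀ i, MeasurableSet (f i)) → Pairwise (Function.onFun Disjoint f) → ∀ n : ℕ,
      c (⋃ i, f i) = ∑ i ∈ Finset.range n, c (f i) + c (⋃ i ≥ n, f i) := by
    intro f hf hd n
    refine tendsto_nhds_unique (hc _) (((tendsto_finsetSum _ fun i _ => hc (f i)).add
      (hc (⋃ i ≥ n, f i))).congr fun j => ?_)
    rw [← measure_biUnion_finset (fun a _ b _ hab => hd hab) fun i _ => hf i,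
      ← measure_union _ (MeasurableSet.iUnion fun i => MeasurableSet.iUnion fun _ => hf i)]
    · congr 1
      ext x
      simp only [Set.mem_union, Set.mem_iUnion, Finset.mem_range, exists_prop]
      constructor
      · rintro (⟨i, -, hi⟩ | ⟨i, -, hi⟩) <;> exact ⟨i, hi⟩
      · rintro ⟨i, hi⟩
        exact (lt_or_ge i n).imp (fun h => ⟨i, h, hi⟩) fun h => ⟨i, h, hi⟩
    · simp only [Set.disjoint_iUnion_left, Set.disjoint_iUnion_right, Finset.mem_range]
      exact fun a ha b hb => hd (by omega)
  have hunion : ∀ ⦃f : ℕ → Set X⦄ (hf : ∀ i, MeasurableSet (f i)), Pairwise (Function.onFun Disjoint f) →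
      c (⋃ i, f i) = ∑' i, c (f i) := by
    intro f hf hd
    -- Domination by the finite `μ` makes tails vanish, upgrading finite to countable additivity.
    have htail : Tendsto (fun n => c (⋃ i ≥ n, f i)) atTop (𝓝 0) := by
      refine tendsto_of_tendsto_of_tendsto_of_le_of_le tendsto_const_nhds ?_
        (fun _ => zero_le) fun n => hcμ _
      exact tendsto_measure_biUnion_Ici_zero_of_pairwise_disjoint
        (fun i => (hf i).nullMeasurableSet) hd
    have := (ENNReal.tendsto_nat_tsum fun i => c (f i)).add htail
    rw [add_zero] at this
    exact tendsto_nhds_unique (tendsto_const_nhds.congr fun n => hadd f hf hd n) this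
  have hempty : c ∅ = 0 := by simpa using hcμ ∅
  refine ⟨Measure.ofMeasurable (fun B _ => c B) hempty hunion, fun B hB => ?_⟩
  rw [Measure.ofMeasurable_apply B hB]
  exact hc B

/-- A finite measure is absolutely continuous with respect to any other one on some measurable set
that carries the latter. -/
theorem exists_carrier [MeasurableSpace X] (μ m : Measure X) [IsFiniteMeasure μ]
    [IsFiniteMeasure m] : ∃ H, MeasurableSet H ∧ m Hᶜ = 0 ∧ ∀ B ⊆ H, m B = 0 → μ B = 0 := by
  -- Lebesgue decomposition: `H` is null for the part of `μ` singular to `m`.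
  obtain ⟨H, hH, h1, h2⟩ := Measure.mutuallySingular_singularPart μ m
  refine ⟨H, hH, h2, fun B hB hmB => ?_⟩
  rw [Measure.haveLebesgueDecomposition_add μ m, Measure.add_apply, measure_mono_null hB h1,
    withDensity_absolutelyContinuous _ _ hmB, add_zero]

/-- The finite measurable partitions of `X`. -/
abbrev MeasurablePartition (X : Type*) [MeasurableSpace X] :=
  {π : Finpartition (Set.univ : Set X) // ∀ A ∈ π.parts, MeasurableSet A}

theorem isCodirected_measurablePartition [MeasurableSpace X] (p q : MeasurablePartition X) :
    ∃ r : MeasurablePartition X, r ≤ p ∧ r ≤ q := by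
  classical
  refine ⟨⟨p.1 ⊓ q.1, fun A hA => ?_⟩, (inf_le_left : p.1 ⊓ q.1 ≤ p.1),
    (inf_le_right : p.1 ⊓ q.1 ≤ q.1)⟩
  rw [Finpartition.parts_inf, Finset.mem_erase, Finset.mem_image] at hA
  obtain ⟨-, ⟨a, b⟩, hab, rfl⟩ := hA
  rw [Finset.mem_product] at hab
  exact (p.2 a hab.1).inter (q.2 b hab.2)

/-- Every measurable set is a union of cells of some finite measurable partition. -/
theorem exists_measurablePartition_subset_or [MeasurableSpace X] {B : Set X}
    (hB : MeasurableSet B) :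
    ∃ p : MeasurablePartition X, ∀ A ∈ p.1.parts, A ⊆ B ∨ A ⊆ Bᶜ := by
  classical
  have hsub : ∀ A ∈ (({B, Bᶜ} : Finset (Set X)).erase ⊥), A = B ∨ A = Bᶜ := fun A hA => by
    simpa using Finset.mem_of_mem_erase hA
  by_cases hBc : B = Bᶜ
  · have : IsEmpty X := ⟨fun x => by
      have := Set.ext_iff.1 hBc x
      simp at this⟩
    exact ⟨⟨⊤, fun A _ => Subsingleton.measurableSet⟩, fun A _ => Or.inl fun x => isEmptyElim x⟩
  refine ⟨⟨Finpartition.ofErase {B, Bᶜ} ?_ ?_, fun A hA => ?_⟩, fun A hA => ?_⟩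
  · rw [Finset.supIndep_pair hBc]
    exact disjoint_compl_right
  · simp
  · rcases hsub A hA with rfl | rfl
    exacts [hB, hB.compl]
  · exact (hsub A hA).imp (fun h => h.le) fun h => h.le

theorem vcDim_eq_top_of_not_finitelyApproximable [MeasurableSpace X] {𝒞 : Set (Set X)}
    (h𝒞 : ∀ C ∈ 𝒞, MeasurableSet C) (μ : Measure X) [IsProbabilityMeasure μ]
    (h : ¬ FinitelyApproximable μ 𝒞) : vcDim 𝒞 = ⊤ := by
  classical
  simp only [FinitelyApproximable, not_forall, not_exists, not_and, not_le] at h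
  obtain ⟨ε, hε, h⟩ := h
  choose! C hC hbd using fun p : MeasurablePartition X => by
    simpa only [exists_prop] using h p.1 p.2
  have : IsDirected (MeasurablePartition X) (· ≥ ·) := ⟨isCodirected_measurablePartition⟩
  have : Nonempty (MeasurablePartition X) :=
    (exists_measurablePartition_subset_or MeasurableSet.empty).nonempty
  let U : Ultrafilter (MeasurablePartition X) := Ultrafilter.of atBot
  have hU : (U : Filter (MeasurablePartition X)) ≤ atBot := Ultrafilter.of_le _
  let D : MeasurablePartition X → Set X := fun p => boundary μ p.1 (C p)
  obtain ⟨m, hm⟩ := exists_ultrafilter_limit_measure U μ (fun p => μ.restrict (D p))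
    fun p => Measure.restrict_le_self
  have hmμ : m Set.univ ≤ μ Set.univ :=
    le_of_tendsto (hm _ MeasurableSet.univ)
      (Eventually.of_forall fun p => Measure.restrict_le_self _)
  have : IsFiniteMeasure m := ⟨hmμ.trans_lt (measure_lt_top _ _)⟩
  have hmpos : 0 < m Set.univ := by
    refine (ENNReal.ofReal_pos.2 hε).trans_le
      (ge_of_tendsto (hm _ MeasurableSet.univ) (Eventually.of_forall fun p => ?_))
    rw [Measure.restrict_apply_univ]
    exact (hbd p).le
  obtain ⟨H, hH, hmH, hHμ⟩ := exists_carrier μ m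
  have hμH : μ H ≠ 0 := fun h0 => by
    have hmle : m H ≤ μ H := le_of_tendsto (hm _ hH)
      (Eventually.of_forall fun p => Measure.restrict_le_self _)
    have := measure_add_measure_compl (μ := m) hH
    rw [hmH, le_antisymm (hmle.trans h0.le) (zero_le), add_zero] at this
    exact hmpos.ne this
  have hsplit : ∀ 𝓑 : Set (Set X), 𝓑.Finite →
      (∀ B ∈ 𝓑, B ⊆ H ∧ MeasurableSet B ∧ μ B ≠ 0) →
      ∃ C ∈ 𝒞, ∀ B ∈ 𝓑, (B ∩ C ⊆ H ∧ MeasurableSet (B ∩ C) ∧ μ (B ∩ C) ≠ 0) ∧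
        (B ∩ Cᶜ ⊆ H ∧ MeasurableSet (B ∩ Cᶜ) ∧ μ (B ∩ Cᶜ) ≠ 0) := by
    intro 𝓑 hfin h𝓑
    have hev : ∀ᶠ p in (U : Filter (MeasurablePartition X)), ∀ B ∈ 𝓑,
        μ (B ∩ C p) ≠ 0 ∧ μ (B ∩ (C p)ᶜ) ≠ 0 := by
      refine (eventually_all_finite hfin).2 fun B hB => ?_
      obtain ⟨hBH, hBm, hB0⟩ := h𝓑 B hB
      obtain ⟨q, hq⟩ := exists_measurablePartition_subset_or hBm
      have hmB : 0 < m B := pos_iff_ne_zero.2 fun h0 => hB0 (hHμ B hBH h0)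
      filter_upwards [(hm B hBm).eventually (lt_mem_nhds hmB), hU (eventually_le_atBot q)]
        with p hp hpq
      rw [Measure.restrict_apply hBm] at hp
      -- As `p` refines `q`, a boundary cell that meets `B` lies inside `B`.
      obtain ⟨x, hxB, A, ⟨hA, hpos⟩, hxA⟩ := nonempty_of_measure_ne_zero hp.ne'
      obtain ⟨A', hA', hAA'⟩ := hpq hA
      have hAB : A ⊆ B := hAA'.trans ((hq A' hA').resolve_right fun h' => h' (hAA' hxA) hxB)
      rw [pos_iff_ne_zero, mul_ne_zero_iff] at hpos
      exact ⟨fun h0 => hpos.1 (measure_mono_null (Set.inter_subset_inter_left _ hAB) h0),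
        fun h0 => hpos.2 (measure_mono_null (Set.inter_subset_inter_left _ hAB) h0)⟩
    obtain ⟨p, hp⟩ := hev.exists
    have hCp := h𝒞 _ (hC p)
    exact ⟨C p, hC p, fun B hB =>
      ⟨⟨Set.inter_subset_left.trans (h𝓑 B hB).1, (h𝓑 B hB).2.1.inter hCp, (hp B hB).1⟩,
        Set.inter_subset_left.trans (h𝓑 B hB).1, (h𝓑 B hB).2.1.inter hCp.compl, (hp B hB).2⟩⟩
  refine vcDim_eq_top_of_independent fun n => ?_
  obtain ⟨C', hC', hs⟩ := exists_independent_of_splitting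
    (fun B hB => nonempty_of_measure_ne_zero hB.2.2) hsplit n {H} (Set.finite_singleton H)
    (by rintro _ rfl; exact ⟨subset_rfl, hH, hμH⟩)
  exact ⟨C', hC', fun s => (hs H rfl s).imp fun x hx => hx.2⟩

end SetFamily

theorem theorem1 {X : Type*} [MeasurableSpace X] (𝒞 : Set (Set X))
    (h𝒞 : ∀ C ∈ 𝒞, MeasurableSet C) :
    (∀ (μ : Measure X) [IsProbabilityMeasure μ],
      SetFamily.FinitelyApproximable μ 𝒞 ∨ SetFamily.vcDim 𝒞 = ⊤) ∧
    (SetFamily.vcDim 𝒞 < ⊤ →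
      ∀ (μ : Measure X) [IsProbabilityMeasure μ], SetFamily.FinitelyApproximable μ 𝒞) := by
  have key : ∀ (μ : Measure X) [IsProbabilityMeasure μ],
      SetFamily.FinitelyApproximable μ 𝒞 ∨ SetFamily.vcDim 𝒞 = ⊤ := fun μ _ =>
    or_iff_not_imp_left.2 (SetFamily.vcDim_eq_top_of_not_finitelyApproximable h𝒞 μ)
  exact ⟨key, fun hfin μ _ => (key μ).resolve_right hfin.ne⟩
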